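/- Let $A=\mathbb F_2[x,y]/(y^2+y=x^3+x+1)$, with the degree function $\deg=-v_\infty$, so that $\deg x=2$, $\deg y=3$. Let $A\{\tau\}$ be the ring of twisted polynomials ($\tau a=a^2\tau$), and let $\rho\colon A\to A\{\tau\}$, $a\mapsto\rho_a$, be the rank-one Drinfeld module given by $$\rho_x=x+(x^2+x)\tau+\tau^2,\qquad \rho_y=y+(y^2+y)\tau+x(y^2+y)\tau^2+\tau^3 .$$ For $f=\sum_k f_k\tau^k\in A\{\tau\}$ and a power series $g$ put $f(g)=\sum_k f_k\,g^{2^k}$. Let $D_k=\prod_{a\in A,\ \deg a=k}a$, and let $L$ be any field containing $A$ (for instance $L=\mathbb C_\infty$, the completion of an algebraic closure of the completion of $\mathrm{Frac}(A)$ at $\infty$). There is a unique power series $e(z)=\sum_{i\ge0}a_iz^{2^i}\in L[[z]]$ with $a_0=1$ and $e(az)=\rho_a(e(z))$ for all $a\in A$ (the exponential of $\rho$), and a unique power series $\log(z)\in L[[z]]$ with zero constant term and $e(\log(z))=z$. They have the form $$e(z)=\sum_{i\ge0}\frac{z^{2^i}}{d_i},\qquad \log(z)=\sum_{i\ge0}\frac{z^{2^i}}{\ell_i}$$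 with all $d_i,\ell_i\in L$ nonzero, and the following hold. 1. $d_2=D_2$. 2. For every $k\ge2$, $d_{k-1}+D_k\neq0$ and $$d_k=\frac{D_kd_{k-1}}{d_{k-1}+D_k}\left(1+D_k+D_{k-1}^2+\cdots+D_2^{2^{k-2}}\right).$$ 3. For every $k\ge2$, $(d_k+D_k^2)\,D_{k-1}D_{k-2}\cdots D_2\neq0$ and $$\ell_k=\frac{D_kd_k}{(d_k+D_k^2)\,(D_{k-1}D_{k-2}\cdots D_2)}$$ (for $k=2$ the product $D_{k-1}\cdots D_2$ is empty, equal to $1$). -/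

import Mathlib

noncomputable section

namespace DrinfeldExample

open Polynomial

/-- The curve `y² + y = x³ + x + 1` over `𝔽₂`. -/
def curve : WeierstrassCurve.Affine (ZMod 2) := ⟨0, 0, 1, 1, 1⟩

/-- `A = 𝔽₂[x, y] / (y² + y = x³ + x + 1)`. -/
abbrev A : Type := curve.CoordinateRing

/-- The class of `x` in `A`. -/
def x : A := WeierstrassCurve.Affine.CoordinateRing.mk curve (C X)

/-- The class of `y` in `A`. -/
def y : A := WeierstrassCurve.Affine.CoordinateRing.mk curve X

theorem two_eq_zero : (2 : A) = 0 := by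
  have h : algebraMap (ZMod 2) A 2 = 2 := map_ofNat _ 2
  rw [← h, show (2 : ZMod 2) = 0 from rfl, map_zero]

instance : CharP A 2 :=
  CharTwo.of_one_ne_zero_of_two_eq_zero one_ne_zero two_eq_zero

theorem curve_eq : y ^ 2 + y = x ^ 3 + x + 1 := by
  have h : WeierstrassCurve.Affine.CoordinateRing.mk curve curve.polynomial = 0 :=
    AdjoinRoot.mk_self
  simp only [WeierstrassCurve.Affine.polynomial, curve, map_add, map_pow, map_zero, map_one, zero_mul, zero_add,
    one_mul, add_zero] at h
  exact sub_eq_zero.mp h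

/-! ### The degree and the products `D k` -/

/-- The degree `deg a = -v_∞(a)`. The place `∞` is the only place of the function field above the
place `1/x` of `𝔽₂(x)` and is totally ramified over it, so `-v_∞(a)` is the degree in `x` of the
norm of `a` from `A` to `𝔽₂[x]`; `deg 0 = ⊥`. The lemmas that follow identify it with the degree
determined by `deg x = 2` and `deg y = 3`. -/
def deg (a : A) : WithBot ℕ := (Algebra.norm (ZMod 2)[X] a).degree

theorem deg_smul_basis (p q : (ZMod 2)[X]) :
    deg (p • (1 : A) + q • y) = max (2 • p.degree) (2 • q.degree + 3) :=
  WeierstrassCurve.Affine.CoordinateRing.degree_norm_smul_basis p q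

theorem deg_mul (a b : A) : deg (a * b) = deg a + deg b := by
  simp [deg]

theorem deg_add_le (a b : A) : deg (a + b) ≤ max (deg a) (deg b) := by
  obtain ⟨p, q, rfl⟩ := WeierstrassCurve.Affine.CoordinateRing.exists_smul_basis_eq a
  obtain ⟨r, s, rfl⟩ := WeierstrassCurve.Affine.CoordinateRing.exists_smul_basis_eq b
  have h : p • (1 : A) + q • y + (r • (1 : A) + s • y) = (p + r) • (1 : A) + (q + s) • y := by
    rw [add_smul, add_smul]
    abel
  change deg (p • (1 : A) + q • y + (r • (1 : A) + s • y)) ≤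
    max (deg (p • (1 : A) + q • y)) (deg (r • (1 : A) + s • y))
  rw [h, deg_smul_basis, deg_smul_basis, deg_smul_basis]
  rcases le_max_iff.mp (degree_add_le p r) with h₁ | h₁ <;>
  rcases le_max_iff.mp (degree_add_le q s) with h₂ | h₂ <;>
  refine max_le ((nsmul_le_nsmul_right h₁ 2).trans ?_)
    ((add_le_add_left (nsmul_le_nsmul_right h₂ 2) 3).trans ?_) <;>
  simp

theorem x_eq_smul : x = (X : (ZMod 2)[X]) • (1 : A) := by
  rw [WeierstrassCurve.Affine.CoordinateRing.smul, mul_one]; rfl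

theorem deg_x : deg x = 2 := by
  have h := deg_smul_basis X 0
  rw [zero_smul, add_zero, ← x_eq_smul] at h
  rw [h]
  simp

theorem deg_y : deg y = 3 := by
  have h := deg_smul_basis 0 1
  rw [zero_smul, zero_add, one_smul] at h
  rw [h]
  simp

theorem finite_deg_eq (k : ℕ) : {a : A | deg a = k}.Finite := by
  have hfin : (Polynomial.degreeLT (ZMod 2) (k + 1) : Set (ZMod 2)[X]).Finite := by
    have : Finite (Polynomial.degreeLT (ZMod 2) (k + 1)) :=
      Finite.of_equiv _ (Polynomial.degreeLTEquiv (ZMod 2) (k + 1)).symm.toEquiv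
    exact Set.toFinite _
  refine ((hfin.prod hfin).image fun r : (ZMod 2)[X] × (ZMod 2)[X] =>
    r.1 • (1 : A) + r.2 • y).subset ?_
  intro a ha
  obtain ⟨p, q, rfl⟩ := WeierstrassCurve.Affine.CoordinateRing.exists_smul_basis_eq a
  have h : max (2 • p.degree) (2 • q.degree + 3) = (k : WithBot ℕ) :=
    (deg_smul_basis p q).symm.trans ha
  have hp : 2 • p.degree ≤ (k : WithBot ℕ) := h ▸ le_max_left _ _
  have hq : 2 • q.degree + 3 ≤ (k : WithBot ℕ) := h ▸ le_max_right _ _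
  refine ⟨(p, q), ⟨?_, ?_⟩, rfl⟩
  · simp only [SetLike.mem_coe, Polynomial.mem_degreeLT]
    by_cases h0 : p = 0
    · simp [h0]
    · rw [Polynomial.degree_eq_natDegree h0] at hp ⊢
      rw [two_nsmul] at hp
      norm_cast at hp ⊢
      omega
  · simp only [SetLike.mem_coe, Polynomial.mem_degreeLT]
    by_cases h0 : q = 0
    · simp [h0]
    · rw [Polynomial.degree_eq_natDegree h0] at hq ⊢
      rw [two_nsmul] at hq
      norm_cast at hq ⊢
      omega

/-- `D k` is the product of all elements of `A` of degree `k`. -/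
def D (k : ℕ) : A := ∏ a ∈ (finite_deg_eq k).toFinset, a

/-! ### The Drinfeld module -/

/-- The action of `ℕ` on `A` by iterates of the Frobenius `a ↦ a ^ 2`. With it,
`SkewPolynomial A` is the twisted polynomial ring `A{τ}`, in which `τ a = a² τ`. -/
instance frobeniusAction : MulSemiringAction (Multiplicative ℕ) A where
  smul n a := a ^ 2 ^ (Multiplicative.toAdd n)
  one_smul a := by
    change a ^ 2 ^ 0 = a
    simp
  mul_smul m n a := by
    change a ^ 2 ^ (Multiplicative.toAdd m + Multiplicative.toAdd n)
      = (a ^ 2 ^ Multiplicative.toAdd n) ^ 2 ^ Multiplicative.toAdd m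
    rw [← pow_mul, pow_add, mul_comm]
  smul_zero n := by
    change (0 : A) ^ 2 ^ Multiplicative.toAdd n = 0
    simp
  smul_add n a b := add_pow_char_pow a b 2 (Multiplicative.toAdd n)
  smul_one n := one_pow _
  smul_mul n a b := mul_pow a b _

theorem smul_eq_pow (n : ℕ) (a : A) : Multiplicative.ofAdd n • a = a ^ 2 ^ n := rfl

/-- `ρ_x = x + (x² + x) τ + τ²`. -/
def rhoX : SkewPolynomial A :=
  SkewPolynomial.monomial 0 x + SkewPolynomial.monomial 1 (x ^ 2 + x) +
    SkewPolynomial.monomial 2 1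

/-- `ρ_y = y + (y² + y) τ + x (y² + y) τ² + τ³`. -/
def rhoY : SkewPolynomial A :=
  SkewPolynomial.monomial 0 y + SkewPolynomial.monomial 1 (y ^ 2 + y) +
    SkewPolynomial.monomial 2 (x * (y ^ 2 + y)) + SkewPolynomial.monomial 3 1

theorem monomial_mul (n m : ℕ) (r s : A) :
    SkewPolynomial.monomial n r * SkewPolynomial.monomial m s
      = SkewPolynomial.monomial (n + m) (r * s ^ 2 ^ n) := by
  rw [SkewPolynomial.monomial_mul_monomial, SkewPolynomial.φ_iterate_apply, smul_eq_pow]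

theorem coeff_add' (p q : SkewPolynomial A) (n : ℕ) :
    (p + q).coeff n = p.coeff n + q.coeff n := by
  simp [SkewPolynomial.coeff]

theorem rhoX_comm_rhoY : Commute rhoX rhoY := by
  have h2 := two_eq_zero
  have hy : y ^ 2 = x ^ 3 + x + 1 - y := by rw [← curve_eq]; ring
  change rhoX * rhoY = rhoY * rhoX
  simp only [rhoX, rhoY, mul_add, add_mul, monomial_mul]
  refine SkewMonoidAlgebra.ext fun n => ?_
  induction n using Multiplicative.rec with | ofAdd n => ?_
  change SkewPolynomial.coeff _ n = SkewPolynomial.coeff _ n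
  simp only [coeff_add', SkewPolynomial.coeff_monomial]
  rcases n with _ | _ | _ | _ | _ | _ | n <;> simp <;> grind

theorem rho_curve_eq : rhoY ^ 2 + rhoY = rhoX ^ 3 + rhoX + 1 := by
  have h2 := two_eq_zero
  have hy : y ^ 2 = x ^ 3 + x + 1 - y := by rw [← curve_eq]; ring
  have h1 : (1 : SkewPolynomial A) = SkewPolynomial.monomial 0 1 := rfl
  rw [pow_two, pow_succ, pow_two, h1]
  simp only [rhoX, rhoY, mul_add, add_mul, monomial_mul]
  refine SkewMonoidAlgebra.ext fun n => ?_
  induction n using Multiplicative.rec with | ofAdd n => ?_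
  change SkewPolynomial.coeff _ n = SkewPolynomial.coeff _ n
  simp only [coeff_add', SkewPolynomial.coeff_monomial]
  rcases n with _ | _ | _ | _ | _ | _ | _ | n <;> simp <;> grind

/-- The embedding of the scalars `𝔽₂` in `A{τ}`. -/
def scalarHom : ZMod 2 →+* SkewPolynomial A :=
  SkewPolynomial.CRingHom.comp (algebraMap (ZMod 2) A)

theorem scalarHom_commute (c : ZMod 2) (p : SkewPolynomial A) : Commute (scalarHom c) p := by
  fin_cases c
  · change Commute (scalarHom 0) p
    simp
  · change Commute (scalarHom 1) p
    simp

/-- The homomorphism `𝔽₂[x] → A{τ}` that sends `x` to `ρ_x`. -/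
def rhoPoly : (ZMod 2)[X] →+* SkewPolynomial A :=
  eval₂RingHom' scalarHom rhoX fun c => scalarHom_commute c rhoX

theorem rhoPoly_commute (p : (ZMod 2)[X]) : Commute (rhoPoly p) rhoY := by
  induction p using Polynomial.induction_on' with
  | add p q hp hq => rw [map_add]; exact hp.add_left hq
  | monomial n c =>
    have h : rhoPoly (monomial n c) = scalarHom c * rhoX ^ n := eval₂_monomial _ _
    rw [h]
    exact (scalarHom_commute c rhoY).mul_left (rhoX_comm_rhoY.pow_left n)

/-- The homomorphism `𝔽₂[x][y] → A{τ}` that sends `x` to `ρ_x` and `y` to `ρ_y`. -/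
def rhoPoly₂ : (ZMod 2)[X][X] →+* SkewPolynomial A :=
  eval₂RingHom' rhoPoly rhoY rhoPoly_commute

theorem rhoPoly_X : rhoPoly X = rhoX := eval₂_X _ _

theorem rhoPoly₂_C (p : (ZMod 2)[X]) : rhoPoly₂ (C p) = rhoPoly p := eval₂_C _ _

theorem rhoPoly₂_X : rhoPoly₂ X = rhoY := eval₂_X _ _

theorem rhoPoly₂_polynomial : rhoPoly₂ curve.polynomial = 0 := by
  have h : curve.polynomial = X ^ 2 + X - (C X ^ 3 + C X + 1) := by
    simp [WeierstrassCurve.Affine.polynomial, curve]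
  refine (congrArg rhoPoly₂ h).trans ?_
  rw [map_sub, sub_eq_zero]
  simp only [map_add, map_pow, map_one, rhoPoly₂_C, rhoPoly₂_X, rhoPoly_X]
  exact rho_curve_eq

/-- The Drinfeld module `ρ : A → A{τ}`, `a ↦ ρ_a`, the ring homomorphism with the given values at
`x` and `y`. -/
def rho : A →+* SkewPolynomial A :=
  Ideal.Quotient.lift (Ideal.span {curve.polynomial}) rhoPoly₂ fun p hp => by
    have h : Ideal.span {curve.polynomial} ≤ RingHom.ker rhoPoly₂ := by
      rw [Ideal.span_singleton_le_iff_mem]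
      exact rhoPoly₂_polynomial
    exact h hp

theorem rho_x : rho x = rhoX := (rhoPoly₂_C X).trans rhoPoly_X

theorem rho_y : rho y = rhoY := rhoPoly₂_X

/-! ### The exponential and the logarithm -/

section Series

open PowerSeries

variable {L : Type*} [Field L]

/-- The power series `∑ i, c i * z ^ (2 ^ i)`. -/
def linearSeries (c : ℕ → L) : L⟦X⟧ :=
  PowerSeries.mk fun n => if n = 2 ^ Nat.log 2 n then c (Nat.log 2 n) else 0

variable [Algebra A L]

/-- The twisted polynomial `f = ∑ f_k τ ^ k` applied to a power series `g`:
`f(g) = ∑ f_k * g ^ (2 ^ k)`. -/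
def twistedApply (f : SkewPolynomial A) (g : L⟦X⟧) : L⟦X⟧ :=
  f.sum fun k c => PowerSeries.C (algebraMap A L c) * g ^ 2 ^ k

/-- `e` is the normalized exponential of `ρ`: it has the form `∑ a_i z ^ (2 ^ i)` with `a_0 = 1`,
and `e(a z) = ρ_a(e(z))` for all `a ∈ A`. -/
structure IsExponential (e : L⟦X⟧) : Prop where
  linear : ∃ a : ℕ → L, a 0 = 1 ∧ e = linearSeries a
  functional_eq : ∀ a : A, PowerSeries.rescale (algebraMap A L a) e = twistedApply (rho a) e

/-- `l` is the formal inverse of `e` at the origin: `l(0) = 0` and `e(l(z)) = z`. -/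
structure IsLogarithm (e l : L⟦X⟧) : Prop where
  constantCoeff_eq_zero : PowerSeries.constantCoeff l = 0
  subst_eq_X : PowerSeries.subst l e = PowerSeries.X

end Series

end DrinfeldExample
end

noncomputable section

namespace DrinfeldExample

/-! ### Twisted power series -/

/-! Additive series `∑ c_i z^(2^i)` compose like twisted series `∑ c_i τ^i`, so an exponential is a
twisted series `E` with constant term `1` and `ρ_a E = E a`, and its logarithm is `g = E⁻¹`. The
equation for `a = x` alone determines `E`, since `x^(2^n) ≠ x` for `n ≥ 1`; the equations for the
other `a` follow because `A` is commutative.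

Write `a_i`, `g_i` for the coefficients of `E` and `g`. From `ρ_a = E a g`, the coefficient of `τ^k`
in `ρ_a` is `P_k(a) = ∑ a_i g_(k-i)^(2^i) a^(2^i)`, an additive polynomial in `a` of degree at most
`2^k`. As `ρ_a` is monic in `τ` of degree `deg a`, `P_k` vanishes on elements of degree `< k` and
equals `1` on those of degree `k`. No element has degree `1`, so for `k ≥ 2` there are only
`2^(k-1)` elements of degree `< k`. With `V` the product of `z + c` over these `c`, this forces `P_k
= a_k V² + μ V` for some `μ` (`exists_comparison`).

Let `v` and `v_0` be the coefficients of `z^(2^(k-2))` and of `z` in `V`. Comparing the coefficients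
of `z^(2^(k-1))` and of `z`, and the values at degree `k`, gives `a_(k-1) = a_k v² + μ`, `g_k = μ
v_0` and `1 = a_k D_k² + μ D_k`. Eliminating `μ` gives both formulas, since `v_0 = D_2 ⋯ D_(k-1)`
and `v² + D_k` is the sum in the formula for `d_k` (`vanishCoeff_zero`, `vanishCoeff_self`). All
nonvanishing follows from degree comparisons in `A`. -/

/-- The twisted power series `∑ f_i τ ^ i` over `L`, in which `τ c = c ^ 2 τ`. -/
@[ext] structure TwistedSeries (L : Type*) where
  /-- The sequence of coefficients. -/
  coeff : ℕ → L

namespace TwistedSeries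

variable {L : Type*}

theorem ext_coeff {f g : TwistedSeries L} (h : ∀ n, f.coeff n = g.coeff n) : f = g :=
  TwistedSeries.ext (funext h)

variable [Field L]

/-- The twisted monomial `c τ ^ i`. -/
def monomial (i : ℕ) (c : L) : TwistedSeries L := ⟨fun n => if n = i then c else 0⟩

instance : Zero (TwistedSeries L) := ⟨⟨fun _ => 0⟩⟩

instance : One (TwistedSeries L) := ⟨monomial 0 1⟩

instance : Add (TwistedSeries L) := ⟨fun f g => ⟨fun n => f.coeff n + g.coeff n⟩⟩

instance : Neg (TwistedSeries L) := ⟨fun f => ⟨fun n => -f.coeff n⟩⟩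

instance : Mul (TwistedSeries L) :=
  ⟨fun f g => ⟨fun n => ∑ p ∈ Finset.HasAntidiagonal.antidiagonal n,
    f.coeff p.1 * g.coeff p.2 ^ 2 ^ p.1⟩⟩

theorem add_coeff (f g : TwistedSeries L) (n : ℕ) :
    (f + g).coeff n = f.coeff n + g.coeff n := rfl

theorem neg_coeff (f : TwistedSeries L) (n : ℕ) : (-f).coeff n = -f.coeff n := rfl

theorem zero_coeff (n : ℕ) : (0 : TwistedSeries L).coeff n = 0 := rfl

theorem one_coeff (n : ℕ) : (1 : TwistedSeries L).coeff n = if n = 0 then 1 else 0 := rfl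

theorem monomial_coeff (i : ℕ) (c : L) (n : ℕ) :
    (monomial i c).coeff n = if n = i then c else 0 := rfl

theorem mul_coeff (f g : TwistedSeries L) (n : ℕ) :
    (f * g).coeff n = ∑ p ∈ Finset.HasAntidiagonal.antidiagonal n,
      f.coeff p.1 * g.coeff p.2 ^ 2 ^ p.1 := rfl

theorem monomial_mul_coeff (i : ℕ) (c : L) (g : TwistedSeries L) (n : ℕ) :
    (monomial i c * g).coeff n = if i ≤ n then c * g.coeff (n - i) ^ 2 ^ i else 0 := by
  rw [mul_coeff]
  split_ifs with h
  · rw [Finset.sum_eq_single (i, n - i)]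
    · simp [monomial_coeff]
    · rintro ⟨j, k⟩ hjk hne
      have hj : j ≠ i := by
        rintro rfl
        simp only [Finset.HasAntidiagonal.mem_antidiagonal] at hjk
        exact hne (by ext <;> simp; omega)
      simp [monomial_coeff, hj]
    · intro hh
      simp only [Finset.HasAntidiagonal.mem_antidiagonal] at hh
      omega
  · refine Finset.sum_eq_zero ?_
    rintro ⟨j, k⟩ hjk
    simp only [Finset.HasAntidiagonal.mem_antidiagonal] at hjk
    have hj : j ≠ i := by omega
    simp [monomial_coeff, hj]

theorem mul_monomial_zero_coeff (f : TwistedSeries L) (c : L) (n : ℕ) :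
    (f * monomial 0 c).coeff n = f.coeff n * c ^ 2 ^ n := by
  rw [mul_coeff, Finset.sum_eq_single (n, 0)]
  · simp [monomial_coeff]
  · rintro ⟨j, k⟩ hjk hne
    have hk : k ≠ 0 := by
      rintro rfl
      simp only [Finset.HasAntidiagonal.mem_antidiagonal] at hjk
      exact hne (by ext <;> simp; omega)
    simp [monomial_coeff, hk]
  · simp

theorem monomial_mul_monomial (i j : ℕ) (c d : L) :
    monomial i c * monomial j d = monomial (i + j) (c * d ^ 2 ^ i) := by
  refine ext_coeff fun n => ?_
  simp only [monomial_mul_coeff, monomial_coeff]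
  by_cases hn : n = i + j
  · simp [hn]
  · rw [if_neg hn]
    split_ifs with h₁ h₂
    · omega
    · simp
    · rfl

/-- A twisted series with constant coefficient `1` has a right inverse with constant
coefficient `1`. -/
theorem exists_mul_eq_one (f : TwistedSeries L) (hf : f.coeff 0 = 1) :
    ∃ g : TwistedSeries L, g.coeff 0 = 1 ∧ f * g = 1 := by
  -- Since `f` has constant coefficient `1`, the coefficient of `τ^n` in `f * g = 1` isolates `g_n`
  -- in terms of earlier coefficients.
  let G : (n : ℕ) → ((m : ℕ) → m < n → L) → L := fun n g =>
    if n = 0 then 1 else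
      -∑ i : Fin n, f.coeff (i + 1) * g (n - 1 - i) (by have := i.2; omega) ^ 2 ^ (i + 1 : ℕ)
  let g : TwistedSeries L := ⟨fun n => Nat.strongRec G n⟩
  have hg : ∀ n, g.coeff n = G n fun m _ => g.coeff m := fun n => Nat.strongRec_eq G n
  have h0 : g.coeff 0 = 1 := by rw [hg]; simp [G]
  refine ⟨g, h0, ?_⟩
  refine ext_coeff fun n => ?_
  rw [one_coeff, mul_coeff]
  rcases n with _ | n
  · simp [hf, h0]
  · rw [if_neg (by omega), Finset.Nat.sum_antidiagonal_succ, hf, hg (n + 1),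
      Finset.Nat.sum_antidiagonal_eq_sum_range_succ_mk, Finset.sum_range]
    simp [G]

variable [CharP L 2]

instance : Ring (TwistedSeries L) :=
  { add_assoc := fun f g h => ext_coeff fun n => add_assoc _ _ _
    zero_add := fun f => ext_coeff fun n => zero_add _
    add_zero := fun f => ext_coeff fun n => add_zero _
    add_comm := fun f g => ext_coeff fun n => add_comm _ _
    neg_add_cancel := fun f => ext_coeff fun n => neg_add_cancel _
    nsmul := nsmulRec
    zsmul := zsmulRec
    zero_mul := fun f => by refine ext_coeff fun n => ?_; simp [mul_coeff, zero_coeff]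
    mul_zero := fun f => by refine ext_coeff fun n => ?_; simp [mul_coeff, zero_coeff]
    one_mul := fun f => by
      refine ext_coeff fun n => ?_
      change (monomial 0 1 * f).coeff n = f.coeff n
      simp [monomial_mul_coeff]
    mul_one := fun f => by
      refine ext_coeff fun n => ?_
      change (f * monomial 0 1).coeff n = f.coeff n
      simp [mul_monomial_zero_coeff]
    left_distrib := fun f g h => by
      refine ext_coeff fun n => ?_
      simp only [mul_coeff, add_coeff, ← Finset.sum_add_distrib, add_pow_char_pow, mul_add]
    right_distrib := fun f g h => by
      refine ext_coeff fun n => ?_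
      simp only [mul_coeff, add_coeff, ← Finset.sum_add_distrib, add_mul]
    mul_assoc := fun f g h => by
      refine ext_coeff fun n => ?_
      simp only [mul_coeff, Finset.sum_mul, sum_pow_char_pow, Finset.mul_sum, Finset.sum_sigma']
      refine Finset.sum_nbij' (fun ⟨⟨_, j⟩, ⟨k, l⟩⟩ => ⟨(k, l + j), (l, j)⟩)
        (fun ⟨⟨i, _⟩, ⟨k, l⟩⟩ => ⟨(i + k, l), (i, k)⟩) ?_ ?_ ?_ ?_ ?_
      · rintro ⟨⟨i, j⟩, ⟨k, l⟩⟩ hh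
        simp only [Finset.mem_sigma, Finset.HasAntidiagonal.mem_antidiagonal, and_true] at hh ⊢
        omega
      · rintro ⟨⟨i, j⟩, ⟨k, l⟩⟩ hh
        simp only [Finset.mem_sigma, Finset.HasAntidiagonal.mem_antidiagonal, and_true] at hh ⊢
        omega
      · rintro ⟨⟨i, j⟩, ⟨k, l⟩⟩ hh
        simp only [Finset.mem_sigma, Finset.HasAntidiagonal.mem_antidiagonal] at hh
        obtain ⟨-, rfl⟩ := hh
        rfl
      · rintro ⟨⟨i, j⟩, ⟨k, l⟩⟩ hh
        simp only [Finset.mem_sigma, Finset.HasAntidiagonal.mem_antidiagonal] at hh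
        obtain ⟨-, rfl⟩ := hh
        rfl
      · rintro ⟨⟨i, j⟩, ⟨k, l⟩⟩ hh
        simp only [Finset.mem_sigma, Finset.HasAntidiagonal.mem_antidiagonal] at hh
        obtain ⟨-, rfl⟩ := hh
        simp only [mul_pow, ← pow_mul, mul_assoc]
        rw [pow_add, mul_comm (2 ^ l)] }

end TwistedSeries

/-! ### Additive power series -/

section LinearSeries

open PowerSeries

variable {L : Type*} [Field L]

theorem coeff_linearSeries (c : ℕ → L) (n : ℕ) :
    coeff n (linearSeries c) = if n = 2 ^ Nat.log 2 n then c (Nat.log 2 n) else 0 :=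
  coeff_mk _ _

@[simp] theorem coeff_two_pow_linearSeries (c : ℕ → L) (m : ℕ) :
    coeff (2 ^ m) (linearSeries c) = c m := by
  simp [coeff_linearSeries, Nat.log_pow]

theorem coeff_linearSeries_of_ne (c : ℕ → L) {n : ℕ} (hn : ∀ m, n ≠ 2 ^ m) :
    coeff n (linearSeries c) = 0 := by
  rw [coeff_linearSeries, if_neg (hn _)]

theorem eq_linearSeries {f : L⟦X⟧} {c : ℕ → L} (h₁ : ∀ m, coeff (2 ^ m) f = c m)
    (h₂ : ∀ n, (∀ m, n ≠ 2 ^ m) → coeff n f = 0) : f = linearSeries c := by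
  ext n
  by_cases hn : ∃ m, n = 2 ^ m
  · obtain ⟨m, rfl⟩ := hn
    simp [h₁]
  · push Not at hn
    rw [h₂ n hn, coeff_linearSeries_of_ne c hn]

theorem linearSeries_injective : Function.Injective (linearSeries (L := L)) := by
  intro c d h
  funext m
  rw [← coeff_two_pow_linearSeries c, h, coeff_two_pow_linearSeries]

theorem constantCoeff_linearSeries (c : ℕ → L) : constantCoeff (linearSeries c) = 0 := by
  rw [← coeff_zero_eq_constantCoeff_apply]
  exact coeff_linearSeries_of_ne c fun m => (pow_pos two_pos m).ne

theorem linearSeries_one : linearSeries (1 : TwistedSeries L).coeff = X := by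
  symm
  refine eq_linearSeries (fun m => ?_) fun n hn => ?_
  · simp [coeff_X, TwistedSeries.one_coeff]
  · rw [coeff_X, if_neg]
    simpa using hn 0

theorem linearSeries_add (f g : TwistedSeries L) :
    linearSeries (f + g).coeff = linearSeries f.coeff + linearSeries g.coeff := by
  symm
  refine eq_linearSeries (fun m => ?_) fun n hn => ?_
  · simp [TwistedSeries.add_coeff]
  · simp [coeff_linearSeries_of_ne _ hn]

theorem linearSeries_zero : linearSeries (0 : TwistedSeries L).coeff = 0 :=
  (eq_linearSeries (fun _ => by simp [TwistedSeries.zero_coeff]) fun _ _ => by simp).symm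

theorem rescale_linearSeries (f : TwistedSeries L) (c : L) :
    rescale c (linearSeries f.coeff) = linearSeries (f * TwistedSeries.monomial 0 c).coeff := by
  refine eq_linearSeries (fun m => ?_) fun n hn => ?_
  · rw [coeff_rescale, coeff_two_pow_linearSeries, TwistedSeries.mul_monomial_zero_coeff, mul_comm]
  · rw [coeff_rescale, coeff_linearSeries_of_ne _ hn, mul_zero]

variable [CharP L 2]

/-- In characteristic two, `f ^ 2 ^ i` applies the iterated Frobenius to the coefficients and
replaces `X` by `X ^ 2 ^ i`. -/
theorem coeff_pow_two_pow (f : L⟦X⟧) (i n : ℕ) :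
    coeff n (f ^ 2 ^ i) = if 2 ^ i ∣ n then coeff (n / 2 ^ i) f ^ 2 ^ i else 0 := by
  have h := MvPowerSeries.map_iterateFrobenius_expand 2 two_ne_zero (f : MvPowerSeries Unit L) i
  have h' : PowerSeries.map (iterateFrobenius L 2 i)
      (PowerSeries.expand (2 ^ i) (pow_ne_zero i two_ne_zero) f) = f ^ 2 ^ i := h
  rw [← h', coeff_map, coeff_expand, iterateFrobenius_def]
  split_ifs <;> simp

theorem C_mul_linearSeries_pow (f : TwistedSeries L) (i : ℕ) (c : L) :
    C c * linearSeries f.coeff ^ 2 ^ i = linearSeries (TwistedSeries.monomial i c * f).coeff := by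
  refine eq_linearSeries (fun m => ?_) fun n hn => ?_
  · rw [coeff_C_mul, coeff_pow_two_pow, TwistedSeries.monomial_mul_coeff]
    by_cases h : i ≤ m
    · rw [if_pos (pow_dvd_pow 2 h), if_pos h, Nat.pow_div h two_pos, coeff_two_pow_linearSeries]
    · rw [if_neg h, if_neg, mul_zero]
      rwa [Nat.pow_dvd_pow_iff_le_right (by norm_num)]
  · rw [coeff_C_mul, coeff_pow_two_pow]
    split_ifs with h
    · obtain ⟨q, rfl⟩ := h
      rw [Nat.mul_div_cancel_left _ (by positivity), coeff_linearSeries_of_ne]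
      · simp
      · rintro m rfl
        exact hn (i + m) (pow_add _ _ _).symm
    · simp

/-- This is what reduces formal inversion of power series to inversion in the twisted ring. -/
theorem subst_linearSeries (f g : TwistedSeries L) :
    subst (linearSeries g.coeff) (linearSeries f.coeff) = linearSeries (f * g).coeff := by
  have hs : HasSubst (linearSeries g.coeff) :=
    HasSubst.of_constantCoeff_zero' (constantCoeff_linearSeries _)
  have key : ∀ n i, coeff (2 ^ i) (linearSeries f.coeff) • coeff n (linearSeries g.coeff ^ 2 ^ i)
      = coeff n (linearSeries (TwistedSeries.monomial i (f.coeff i) * g).coeff) := by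
    intro n i
    rw [← C_mul_linearSeries_pow, coeff_C_mul, coeff_two_pow_linearSeries, smul_eq_mul]
  refine eq_linearSeries (fun m => ?_) fun n hn => ?_
  · rw [coeff_subst' hs, finsum_eq_sum_of_support_subset
      (s := (Finset.range (m + 1)).image fun i => 2 ^ i)]
    · rw [Finset.sum_image (fun i _ j _ h => Nat.pow_right_injective le_rfl h),
        TwistedSeries.mul_coeff, Finset.Nat.sum_antidiagonal_eq_sum_range_succ_mk]
      refine Finset.sum_congr rfl fun i hi => ?_
      rw [key, coeff_two_pow_linearSeries, TwistedSeries.monomial_mul_coeff, if_pos]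
      simpa [Nat.lt_succ_iff] using hi
    · intro d hd
      rw [Function.mem_support] at hd
      by_cases hd' : ∃ i, d = 2 ^ i
      · obtain ⟨i, rfl⟩ := hd'
        rw [key, coeff_two_pow_linearSeries, TwistedSeries.monomial_mul_coeff] at hd
        have : i ≤ m := by
          by_contra hi
          exact hd (if_neg hi)
        simpa [Nat.lt_succ_iff] using this
      · push Not at hd'
        rw [coeff_linearSeries_of_ne _ hd', zero_smul] at hd
        exact absurd rfl hd
  · rw [coeff_subst' hs, finsum_eq_zero_of_forall_eq_zero]
    intro d
    by_cases hd' : ∃ i, d = 2 ^ i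
    · obtain ⟨i, rfl⟩ := hd'
      rw [key, coeff_linearSeries_of_ne _ hn]
    · push Not at hd'
      rw [coeff_linearSeries_of_ne _ hd', zero_smul]

/-- If `f * g = 1`, then `linearSeries g.coeff` is the only formal inverse of `linearSeries f.coeff`. -/
theorem isLogarithm_linearSeries_iff {f g : TwistedSeries L} (hf : f.coeff 0 = 1)
    (hfg : f * g = 1) (l : L⟦X⟧) : IsLogarithm (linearSeries f.coeff) l ↔ l = linearSeries g.coeff := by
  have hu : IsUnit (coeff 1 (linearSeries f.coeff)) := by
    rw [← pow_zero 2, coeff_two_pow_linearSeries, hf]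
    exact isUnit_one
  let := hu.invertible
  have hinv := subst_substInv_left (linearSeries f.coeff) (constantCoeff_linearSeries _)
  have huniq : ∀ l : L⟦X⟧, IsLogarithm (linearSeries f.coeff) l → l = substInv (linearSeries f.coeff) := by
    intro l hl
    have hsl : HasSubst l := HasSubst.of_constantCoeff_zero' hl.constantCoeff_eq_zero
    have hsf : HasSubst (linearSeries f.coeff) :=
      HasSubst.of_constantCoeff_zero' (constantCoeff_linearSeries _)
    -- By associativity of substitution, the left inverse of `e`, composed with `e(l) = X`, is both
    -- itself and `l`.
    have h := subst_comp_subst_apply hsf hsl (substInv (linearSeries f.coeff))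
    rw [hinv, subst_X hsl, hl.subst_eq_X, X_subst] at h
    exact h
  have hg : IsLogarithm (linearSeries f.coeff) (linearSeries g.coeff) :=
    ⟨constantCoeff_linearSeries _, by rw [subst_linearSeries, hfg, linearSeries_one]⟩
  constructor
  · intro hl
    rw [huniq l hl, huniq _ hg]
  · rintro rfl
    exact hg

end LinearSeries

/-! ### The exponential of `ρ` -/

section Exponential

variable {L : Type*} [Field L] [Algebra A L]

theorem deg_x_pow (m : ℕ) : deg (x ^ m) = (2 * m : ℕ) := by
  induction m with
  | zero => simp [deg]
  | succ m ih =>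
    rw [pow_succ, deg_mul, ih, deg_x]
    norm_cast

/-- Keeps the denominators in the recursion for the exponential nonzero. -/
theorem x_pow_two_pow_ne (n : ℕ) : x ^ 2 ^ (n + 1) ≠ x := by
  intro h
  have h' := congrArg deg h
  rw [deg_x_pow, deg_x] at h'
  have h₂ : 2 * 2 ^ (n + 1) = 2 := by exact_mod_cast h'
  have := Nat.one_lt_two_pow (n := n + 1) (by omega)
  omega

variable [CharP L 2]

/-- A twisted polynomial over `A` as a twisted series over `L`. -/
def toSeries : SkewPolynomial A →+* TwistedSeries L where
  toFun f := ⟨fun k => algebraMap A L (f.coeff k)⟩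
  map_zero' := TwistedSeries.ext_coeff fun n => map_zero _
  map_one' := TwistedSeries.ext_coeff fun n => by
    simp [SkewPolynomial.coeff_one, TwistedSeries.one_coeff, eq_comm, apply_ite]
  map_add' f g := TwistedSeries.ext_coeff fun n => by
    simp [SkewPolynomial.coeff_add, TwistedSeries.add_coeff]
  map_mul' f g := by
    -- The same map, bundled as additive, so that multiplicativity need only be checked on
    -- monomials.
    let φ : SkewPolynomial A →+ TwistedSeries L :=
      { toFun := fun f => ⟨fun k => algebraMap A L (f.coeff k)⟩
        map_zero' := TwistedSeries.ext_coeff fun n => map_zero _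
        map_add' := fun f g => TwistedSeries.ext_coeff fun n => by
          simp [SkewPolynomial.coeff_add, TwistedSeries.add_coeff] }
    have hmon : ∀ i (c : A),
        φ (SkewPolynomial.monomial i c) = TwistedSeries.monomial i (algebraMap A L c) := by
      intro i c
      refine TwistedSeries.ext_coeff fun n => ?_
      change algebraMap A L (SkewPolynomial.coeff _ n) = _
      rw [SkewPolynomial.coeff_monomial, TwistedSeries.monomial_coeff]
      by_cases h : n = i
      · simp [h]
      · simp [h, Ne.symm h]
    change φ (f * g) = φ f * φ g
    induction f using SkewPolynomial.induction with
    | h0 => simp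
    | ha n r q _ _ ih =>
      rw [add_mul, map_add, ih, map_add, add_mul]
      congr 1
      clear ih
      induction g using SkewPolynomial.induction with
      | h0 => simp
      | ha m s q _ _ ih =>
        rw [mul_add, map_add, ih, map_add, mul_add, monomial_mul, hmon, hmon, hmon,
          TwistedSeries.monomial_mul_monomial, map_mul, map_pow]

theorem toSeries_coeff (f : SkewPolynomial A) (n : ℕ) :
    (toSeries f : TwistedSeries L).coeff n = algebraMap A L (f.coeff n) := rfl

theorem toSeries_monomial (i : ℕ) (c : A) :
    (toSeries (SkewPolynomial.monomial i c) : TwistedSeries L)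
      = TwistedSeries.monomial i (algebraMap A L c) := by
  refine TwistedSeries.ext_coeff fun n => ?_
  rw [toSeries_coeff, SkewPolynomial.coeff_monomial, TwistedSeries.monomial_coeff]
  by_cases h : n = i
  · simp [h]
  · simp [h, Ne.symm h]

theorem twistedApply_linearSeries (p : SkewPolynomial A) (f : TwistedSeries L) :
    twistedApply p (linearSeries f.coeff) = linearSeries (toSeries p * f).coeff := by
  induction p using SkewPolynomial.induction with
  | h0 => simp [twistedApply, SkewPolynomial.sum_zero_index, linearSeries_zero]
  | ha n r q _ _ ih =>
    rw [map_add, add_mul, linearSeries_add, ← ih, toSeries_monomial, ← C_mul_linearSeries_pow]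
    unfold twistedApply
    rw [SkewPolynomial.sum_add_index _ _ _ (by simp) (by intros; simp [add_mul]),
      SkewPolynomial.sum_monomial_index (by simp)]

theorem isExponential_linearSeries_iff (f : TwistedSeries L) :
    IsExponential (linearSeries f.coeff) ↔ f.coeff 0 = 1 ∧ ∀ a : A,
      toSeries (rho a) * f = f * TwistedSeries.monomial 0 (algebraMap A L a) := by
  constructor
  · rintro ⟨⟨c, hc, hfc⟩, h⟩
    refine ⟨by rw [linearSeries_injective hfc, hc], fun a => ?_⟩
    have := h a
    rw [rescale_linearSeries, twistedApply_linearSeries] at this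
    exact TwistedSeries.ext (linearSeries_injective this).symm
  · rintro ⟨h0, h⟩
    refine ⟨⟨f.coeff, h0, rfl⟩, fun a => ?_⟩
    rw [rescale_linearSeries, twistedApply_linearSeries, h a]

theorem toSeries_rho_coeff_zero (a : A) :
    (toSeries (rho a) : TwistedSeries L).coeff 0 = algebraMap A L a := by
  let c : TwistedSeries L →+* L :=
    { toFun := fun f => f.coeff 0
      map_zero' := rfl
      map_one' := rfl
      map_add' := fun _ _ => rfl
      map_mul' := fun f g => by simp [TwistedSeries.mul_coeff] }
  have h : c.comp (toSeries.comp rho) = algebraMap A L := by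
    refine Ideal.Quotient.ringHom_ext ?_
    refine Polynomial.ringHom_ext' (Polynomial.ringHom_ext' (Subsingleton.elim _ _) ?_) ?_
    · change (toSeries (rho x) : TwistedSeries L).coeff 0 = algebraMap A L x
      rw [rho_x, toSeries_coeff]
      simp [rhoX, SkewPolynomial.coeff_monomial]
    · change (toSeries (rho y) : TwistedSeries L).coeff 0 = algebraMap A L y
      rw [rho_y, toSeries_coeff]
      simp [rhoY, SkewPolynomial.coeff_monomial]
  exact RingHom.congr_fun h a

theorem toSeries_rhoX_mul_coeff (f : TwistedSeries L) (n : ℕ) :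
    (toSeries (rho x) * f).coeff n = algebraMap A L x * f.coeff n +
      (if 1 ≤ n then algebraMap A L (x ^ 2 + x) * f.coeff (n - 1) ^ 2 else 0) +
      (if 2 ≤ n then f.coeff (n - 2) ^ 4 else 0) := by
  rw [rho_x, rhoX, map_add, map_add, add_mul, add_mul, toSeries_monomial, toSeries_monomial,
    toSeries_monomial]
  simp [TwistedSeries.add_coeff, TwistedSeries.monomial_mul_coeff]

/-- A twisted series that intertwines multiplication by `x` with `ρ_x` is determined by its
constant coefficient. -/
theorem eq_zero_of_intertwines (hL : Function.Injective (algebraMap A L)) {f : TwistedSeries L}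
    (h0 : f.coeff 0 = 0)
    (h : toSeries (rho x) * f = f * TwistedSeries.monomial 0 (algebraMap A L x)) : f = 0 := by
  refine TwistedSeries.ext_coeff fun n => ?_
  rw [TwistedSeries.zero_coeff]
  induction n using Nat.strong_induction_on with
  | _ n ih =>
    rcases n with _ | n
    · exact h0
    · have hn := congrArg (fun g => g.coeff (n + 1)) h
      simp only [toSeries_rhoX_mul_coeff, TwistedSeries.mul_monomial_zero_coeff] at hn
      -- With the lower coefficients gone, only `x f_(n+1) = f_(n+1) x^(2^(n+1))` remains.
      rw [ih _ (by omega : n + 1 - 1 < n + 1), ih _ (by omega : n + 1 - 2 < n + 1)] at hn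
      simp only [ne_eq, OfNat.ofNat_ne_zero, not_false_eq_true, zero_pow, mul_zero, ite_self,
        add_zero] at hn
      by_contra hf
      have hx : algebraMap A L x = algebraMap A L x ^ 2 ^ (n + 1) :=
        mul_right_cancel₀ hf (hn.trans (mul_comm _ _))
      rw [← map_pow] at hx
      exact x_pow_two_pow_ne n (hL hx).symm

variable (L) in
/-- The coefficients of the exponential of `ρ`, by the recursion that expresses
`e(x z) = ρ_x(e(z))`. -/
def expCoeff : ℕ → L
  | 0 => 1
  | 1 => 1
  | n + 2 => (algebraMap A L (x ^ 2 + x) * expCoeff (n + 1) ^ 2 + expCoeff n ^ 4) /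
      (algebraMap A L x ^ 2 ^ (n + 2) - algebraMap A L x)

variable (L) in
/-- The exponential of `ρ` as a twisted series. -/
def expSeries : TwistedSeries L := ⟨expCoeff L⟩

theorem toSeries_rho_x_mul_expSeries (hL : Function.Injective (algebraMap A L)) :
    toSeries (rho x) * expSeries L
      = expSeries L * TwistedSeries.monomial 0 (algebraMap A L x) := by
  refine TwistedSeries.ext_coeff fun n => ?_
  rw [toSeries_rhoX_mul_coeff, TwistedSeries.mul_monomial_zero_coeff]
  rcases n with _ | _ | n
  · simp [expSeries, expCoeff]
  · simp only [expSeries, expCoeff]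
    -- The coefficient of `τ` reads `x + (x² + x) = x²`, so the value `1` of `expCoeff` at `1` is
    -- correct in characteristic two.
    have : (2 : L) = 0 := CharTwo.two_eq_zero
    simp [expCoeff]
    linear_combination algebraMap A L x * this
  · have h : algebraMap A L x ^ 2 ^ (n + 2) - algebraMap A L x ≠ 0 := by
      rw [sub_ne_zero, ← map_pow]
      exact fun h => x_pow_two_pow_ne (n + 1) (hL h)
    simp only [expSeries, expCoeff]
    simp only [show n + 1 + 1 - 1 = n + 1 by omega,
      show n + 1 + 1 - 2 = n by omega]
    rw [if_pos (by omega), if_pos (by omega)]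
    change _ = _ * algebraMap A L x ^ 2 ^ (n + 2)
    field_simp
    ring

/-- The difference of the two sides has constant coefficient `0` and, since `ρ_a` commutes with
`ρ_x`, again intertwines `x` with `ρ_x`; hence it is zero. -/
theorem toSeries_rho_mul_expSeries (hL : Function.Injective (algebraMap A L)) (a : A) :
    toSeries (rho a) * expSeries L
      = expSeries L * TwistedSeries.monomial 0 (algebraMap A L a) := by
  rw [← sub_eq_zero]
  have hx := toSeries_rho_x_mul_expSeries (L := L) hL
  refine eq_zero_of_intertwines hL ?_ ?_
  · rw [sub_eq_add_neg, TwistedSeries.add_coeff, TwistedSeries.neg_coeff,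
      TwistedSeries.mul_monomial_zero_coeff, TwistedSeries.mul_coeff]
    simp [toSeries_rho_coeff_zero, expSeries, expCoeff]
  · have hcomm : (toSeries (rho x) * toSeries (rho a) : TwistedSeries L)
        = toSeries (rho a) * toSeries (rho x) := by
      rw [← map_mul, ← map_mul, ← map_mul, ← map_mul, mul_comm]
    have hcomm' : TwistedSeries.monomial 0 (algebraMap A L x) *
        TwistedSeries.monomial 0 (algebraMap A L a) =
        TwistedSeries.monomial 0 (algebraMap A L a) *
          TwistedSeries.monomial 0 (algebraMap A L x) := by
      simp [TwistedSeries.monomial_mul_monomial, mul_comm]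
    rw [mul_sub, sub_mul, ← mul_assoc, hcomm, mul_assoc, hx, ← mul_assoc, ← mul_assoc, hx,
      mul_assoc (expSeries L), hcomm', mul_assoc (expSeries L)]

theorem isExponential_iff (hL : Function.Injective (algebraMap A L)) (e : PowerSeries L) :
    IsExponential e ↔ e = linearSeries (expCoeff L) := by
  have hE : IsExponential (linearSeries (expSeries L).coeff) :=
    (isExponential_linearSeries_iff _).mpr ⟨rfl, toSeries_rho_mul_expSeries hL⟩
  constructor
  · intro he
    obtain ⟨c, -, rfl⟩ := he.linear
    obtain ⟨h0, h⟩ := (isExponential_linearSeries_iff (⟨c⟩ : TwistedSeries L)).mp he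
    have : (⟨c⟩ : TwistedSeries L) - expSeries L = 0 := by
      refine eq_zero_of_intertwines hL ?_ ?_
      · rw [sub_eq_add_neg, TwistedSeries.add_coeff, TwistedSeries.neg_coeff, h0]
        simp [expSeries, expCoeff]
      · rw [mul_sub, sub_mul, h, toSeries_rho_x_mul_expSeries hL]
    rw [sub_eq_zero] at this
    exact congrArg (fun f : TwistedSeries L => linearSeries f.coeff) this
  · rintro rfl
    exact hE

end Exponential

/-! ### The degree -/

open Polynomial in
theorem nsmul_degree_add_lt_iff (p : (ZMod 2)[X]) (k n : ℕ) :
    2 • p.degree + (k : WithBot ℕ) < (n : WithBot ℕ) ↔ ∀ i, n ≤ 2 * i + k → p.coeff i = 0 := by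
  by_cases hp : p = 0
  · simp [hp]
  · rw [degree_eq_natDegree hp, two_nsmul]
    norm_cast
    constructor
    · intro h i hi
      exact coeff_eq_zero_of_natDegree_lt (by omega)
    · intro h
      by_contra hn
      exact hp (leadingCoeff_eq_zero.mp (h p.natDegree (by omega)))

open Polynomial in
theorem deg_smul_basis_lt_iff (p q : (ZMod 2)[X]) (n : ℕ) :
    deg (p • (1 : A) + q • y) < n ↔
      (∀ i, n ≤ 2 * i → p.coeff i = 0) ∧ ∀ i, n ≤ 2 * i + 3 → q.coeff i = 0 := by
  rw [deg_smul_basis, max_lt_iff]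
  have h₁ := nsmul_degree_add_lt_iff p 0 n
  have h₂ := nsmul_degree_add_lt_iff q 3 n
  simp only [Nat.cast_zero, add_zero] at h₁
  rw [h₁, ← h₂]
  rfl

-- The numbers `2i` and `2i + 3` have different parity, so the two parts never compete for the
-- leading term, and over `𝔽₂` its coefficient is `1`.
open Polynomial in
theorem exists_coeff_of_deg_smul_basis_eq {p q : (ZMod 2)[X]} {n : ℕ}
    (h : deg (p • (1 : A) + q • y) = n) :
    (∃ i, n = 2 * i ∧ p.coeff i = 1) ∨ ∃ i, n = 2 * i + 3 ∧ q.coeff i = 1 := by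
  have h₁ : deg (p • (1 : A) + q • y) < (n + 1 : ℕ) := by
    rw [h]
    exact_mod_cast n.lt_succ_self
  have h₂ : ¬ deg (p • (1 : A) + q • y) < n := by rw [h]; exact lt_irrefl _
  rw [deg_smul_basis_lt_iff] at h₁ h₂
  have hone : ∀ c : ZMod 2, c ≠ 0 → c = 1 := by decide
  by_cases hp : ∀ i, n ≤ 2 * i → p.coeff i = 0
  · have hq : ¬ ∀ i, n ≤ 2 * i + 3 → q.coeff i = 0 := fun hq => h₂ ⟨hp, hq⟩
    push Not at hq
    obtain ⟨i, hi, hqi⟩ := hq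
    refine Or.inr ⟨i, ?_, hone _ hqi⟩
    by_contra hne
    exact hqi (h₁.2 i (by omega))
  · push Not at hp
    obtain ⟨i, hi, hpi⟩ := hp
    refine Or.inl ⟨i, ?_, hone _ hpi⟩
    by_contra hne
    exact hpi (h₁.1 i (by omega))

theorem deg_zero : deg 0 = ⊥ := by simpa using deg_smul_basis 0 0

theorem deg_one : deg 1 = 0 := by simp [deg]

theorem deg_eq_bot_iff {a : A} : deg a = ⊥ ↔ a = 0 := by
  constructor
  · intro h
    obtain ⟨p, q, rfl⟩ := WeierstrassCurve.Affine.CoordinateRing.exists_smul_basis_eq a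
    have h' : deg (p • (1 : A) + q • y) < (0 : ℕ) := by
      change deg (p • (1 : A) + q • y) = ⊥ at h
      rw [h]
      exact WithBot.bot_lt_coe 0
    rw [deg_smul_basis_lt_iff] at h'
    have hp : p = 0 := Polynomial.ext fun i => by simpa using h'.1 i (by omega)
    have hq : q = 0 := Polynomial.ext fun i => by simpa using h'.2 i (by omega)
    simp [hp, hq]
  · rintro rfl
    exact deg_zero

theorem exists_deg_eq {a : A} (ha : a ≠ 0) : ∃ n : ℕ, deg a = n := by
  obtain ⟨n, hn⟩ := WithBot.ne_bot_iff_exists.mp (fun h => ha (deg_eq_bot_iff.mp h))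
  exact ⟨n, hn.symm⟩

/-- The one gap in the degrees, as the curve has genus one. It halves the count in `card_degLT` and
so is the source of the extra unknown `μ` in `exists_comparison`. -/
theorem deg_ne_one (a : A) : deg a ≠ (1 : ℕ) := by
  obtain ⟨p, q, rfl⟩ := WeierstrassCurve.Affine.CoordinateRing.exists_smul_basis_eq a
  intro h
  rcases exists_coeff_of_deg_smul_basis_eq h with ⟨i, hi, -⟩ | ⟨i, hi, -⟩ <;> omega

/-- All leading coefficients are `1`, so the leading terms of two elements of the same degree
cancel. -/
theorem deg_add_lt {a b : A} {n : ℕ} (ha : deg a = n) (hb : deg b = n) : deg (a + b) < n := by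
  obtain ⟨p, q, rfl⟩ := WeierstrassCurve.Affine.CoordinateRing.exists_smul_basis_eq a
  obtain ⟨r, s, rfl⟩ := WeierstrassCurve.Affine.CoordinateRing.exists_smul_basis_eq b
  change deg (p • (1 : A) + q • y) = n at ha
  change deg (r • (1 : A) + s • y) = n at hb
  change deg (p • (1 : A) + q • y + (r • (1 : A) + s • y)) < n
  have h : p • (1 : A) + q • y + (r • (1 : A) + s • y) = (p + r) • (1 : A) + (q + s) • y := by
    rw [add_smul, add_smul]
    abel
  have hlt : deg ((p + r) • (1 : A) + (q + s) • y) < (n + 1 : ℕ) := by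
    rw [← h]
    refine (deg_add_le _ _).trans_lt ?_
    rw [ha, hb, max_self]
    exact_mod_cast n.lt_succ_self
  rw [deg_smul_basis_lt_iff] at hlt
  have h11 : (1 : ZMod 2) + 1 = 0 := by decide
  rw [h, deg_smul_basis_lt_iff]
  rcases exists_coeff_of_deg_smul_basis_eq ha with ⟨i, hi, hpi⟩ | ⟨i, hi, hpi⟩ <;>
  rcases exists_coeff_of_deg_smul_basis_eq hb with ⟨j, hj, hrj⟩ | ⟨j, hj, hrj⟩
  · obtain rfl : i = j := by omega
    refine ⟨fun m hm => ?_, fun m hm => hlt.2 m (by omega)⟩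
    by_cases hmi : m = i
    · rw [hmi, Polynomial.coeff_add, hpi, hrj, h11]
    · exact hlt.1 m (by omega)
  · omega
  · omega
  · obtain rfl : i = j := by omega
    refine ⟨fun m hm => hlt.1 m (by omega), fun m hm => ?_⟩
    by_cases hmi : m = i
    · rw [hmi, Polynomial.coeff_add, hpi, hrj, h11]
    · exact hlt.2 m (by omega)

theorem deg_add_eq_left {a b : A} (h : deg b < deg a) : deg (a + b) = deg a := by
  refine le_antisymm ((deg_add_le a b).trans (max_le le_rfl h.le)) ?_
  by_contra hlt
  rw [not_le] at hlt
  have h' := deg_add_le (a + b) b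
  rw [add_assoc, CharTwo.add_self_eq_zero, add_zero] at h'
  exact (h'.trans_lt (max_lt hlt h)).false

theorem exists_pow_deg_eq {n : ℕ} (hn : n ≠ 1) :
    ∃ m, (n = 2 * m ∧ deg (x ^ m) = n) ∨ (n = 2 * m + 3 ∧ deg (x ^ m * y) = n) := by
  rcases Nat.even_or_odd' n with ⟨m, rfl | rfl⟩
  · exact ⟨m, Or.inl ⟨rfl, deg_x_pow m⟩⟩
  · refine ⟨m - 1, Or.inr ⟨by omega, ?_⟩⟩
    rw [deg_mul, deg_x_pow, deg_y]
    norm_cast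
    omega

theorem exists_of_deg {n : ℕ} (hn : n ≠ 1) : ∃ b : A, deg b = n := by
  obtain ⟨m, ⟨-, h⟩ | ⟨-, h⟩⟩ := exists_pow_deg_eq hn
  · exact ⟨_, h⟩
  · exact ⟨_, h⟩

/-! ### The `τ`-degree of `ρ_a` -/

namespace TwistedSeries

variable {L : Type*} [Field L]

/-- A twisted series is monic of degree `n` if it is a polynomial in `τ` with leading
term `τ ^ n`. -/
def MonicOfDegree (f : TwistedSeries L) (n : ℕ) : Prop :=
  f.coeff n = 1 ∧ ∀ m, n < m → f.coeff m = 0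

theorem monicOfDegree_one : MonicOfDegree (1 : TwistedSeries L) 0 :=
  ⟨rfl, fun _ hm => if_neg hm.ne'⟩

theorem MonicOfDegree.mul {f g : TwistedSeries L} {n m : ℕ} (hf : f.MonicOfDegree n)
    (hg : g.MonicOfDegree m) : (f * g).MonicOfDegree (n + m) := by
  constructor
  · rw [mul_coeff, Finset.sum_eq_single (n, m)]
    · simp [hf.1, hg.1]
    · rintro ⟨i, j⟩ hij hne
      rw [Finset.HasAntidiagonal.mem_antidiagonal] at hij
      rcases lt_trichotomy i n with h | h | h
      · simp [hg.2 j (by simp only at hij; omega)]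
      · exact absurd (by ext <;> simp only at hij ⊢ <;> omega) hne
      · simp [hf.2 i h]
    · simp
  · intro k hk
    rw [mul_coeff]
    refine Finset.sum_eq_zero ?_
    rintro ⟨i, j⟩ hij
    rw [Finset.HasAntidiagonal.mem_antidiagonal] at hij
    by_cases h : n < i
    · simp [hf.2 i h]
    · simp [hg.2 j (by simp only at hij; omega)]

variable [CharP L 2]

theorem MonicOfDegree.pow {f : TwistedSeries L} {n : ℕ} (hf : f.MonicOfDegree n) (m : ℕ) :
    (f ^ m).MonicOfDegree (n * m) := by
  induction m with
  | zero => simpa using monicOfDegree_one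
  | succ m ih =>
    rw [pow_succ, Nat.mul_succ]
    exact ih.mul hf

end TwistedSeries

section Leading

variable {L : Type*} [Field L] [Algebra A L] [CharP L 2]

theorem monicOfDegree_rho_x : (toSeries (rho x) : TwistedSeries L).MonicOfDegree 2 := by
  rw [rho_x]
  refine ⟨?_, fun m hm => ?_⟩
  · rw [toSeries_coeff]
    simp only [rhoX, SkewPolynomial.coeff_add, SkewPolynomial.coeff_monomial]
    simp
  · rw [toSeries_coeff]
    simp only [rhoX, SkewPolynomial.coeff_add, SkewPolynomial.coeff_monomial]
    rw [if_neg (by omega), if_neg (by omega), if_neg (by omega)]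
    simp

theorem monicOfDegree_rho_y : (toSeries (rho y) : TwistedSeries L).MonicOfDegree 3 := by
  rw [rho_y]
  refine ⟨?_, fun m hm => ?_⟩
  · rw [toSeries_coeff]
    simp only [rhoY, SkewPolynomial.coeff_add, SkewPolynomial.coeff_monomial]
    simp
  · rw [toSeries_coeff]
    simp only [rhoY, SkewPolynomial.coeff_add, SkewPolynomial.coeff_monomial]
    rw [if_neg (by omega), if_neg (by omega), if_neg (by omega), if_neg (by omega)]
    simp

/-- `ρ_a` is monic in `τ` of degree `deg a`. -/
theorem monicOfDegree_rho {n : ℕ} {a : A} (ha : deg a = n) :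
    (toSeries (rho a) : TwistedSeries L).MonicOfDegree n := by
  induction n using Nat.strong_induction_on generalizing a with
  | _ n ih =>
    -- The statement is clear for the monomial `b` of degree `n`; as `b + a` has smaller degree,
    -- induction shows that it does not affect the leading term.
    obtain ⟨b, hb, hbm⟩ : ∃ b : A, deg b = n ∧
        (toSeries (rho b) : TwistedSeries L).MonicOfDegree n := by
      obtain ⟨m, ⟨hm, h⟩ | ⟨hm, h⟩⟩ := exists_pow_deg_eq (n := n)
        (by rintro rfl; exact deg_ne_one a ha)
      · refine ⟨_, h, ?_⟩
        rw [map_pow, map_pow, hm]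
        exact monicOfDegree_rho_x.pow m
      · refine ⟨_, h, ?_⟩
        rw [map_mul, map_mul, map_pow, map_pow, hm]
        exact (monicOfDegree_rho_x.pow m).mul monicOfDegree_rho_y
    have hlow : ∀ m, n ≤ m → (toSeries (rho (b + a)) : TwistedSeries L).coeff m = 0 := by
      intro m hm
      by_cases h0 : b + a = 0
      · rw [h0, map_zero, map_zero, TwistedSeries.zero_coeff]
      · obtain ⟨k, hk⟩ := exists_deg_eq h0
        have hlt := deg_add_lt hb ha
        rw [hk] at hlt
        have hlt' : k < n := by exact_mod_cast hlt
        exact (ih k hlt' hk).2 m (by omega)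
    have hsum : a = b + (b + a) := by
      rw [← add_assoc, CharTwo.add_self_eq_zero, zero_add]
    rw [hsum, map_add, map_add]
    refine ⟨?_, fun m hm => ?_⟩
    · rw [TwistedSeries.add_coeff, hbm.1, hlow n le_rfl, add_zero]
    · rw [TwistedSeries.add_coeff, hbm.2 m hm, hlow m hm.le, add_zero]

theorem toSeries_rho_coeff_eq_zero {n : ℕ} {a : A} (ha : deg a < n) :
    (toSeries (rho a) : TwistedSeries L).coeff n = 0 := by
  by_cases h0 : a = 0
  · rw [h0, map_zero, map_zero, TwistedSeries.zero_coeff]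
  · obtain ⟨k, hk⟩ := exists_deg_eq h0
    rw [hk] at ha
    exact (monicOfDegree_rho hk).2 n (by exact_mod_cast ha)

end Leading

/-! ### The additive polynomial that vanishes on the elements of small degree -/

theorem finite_deg_lt (k : ℕ) : {a : A | deg a < k}.Finite := by
  refine ((Set.finite_singleton (0 : A)).union
    ((Finset.range k).finite_toSet.biUnion fun i _ => finite_deg_eq i)).subset fun a ha => ?_
  by_cases h0 : a = 0
  · exact Or.inl h0
  · obtain ⟨n, hn⟩ := exists_deg_eq h0
    refine Or.inr (Set.mem_biUnion (x := n) ?_ hn)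
    have ha' : deg a < k := ha
    rw [hn] at ha'
    simpa using ha'

/-- The elements of `A` of degree less than `k`. -/
def degLT (k : ℕ) : Finset A := (finite_deg_lt k).toFinset

theorem mem_degLT {k : ℕ} {a : A} : a ∈ degLT k ↔ deg a < k := by simp [degLT]

theorem deg_lt_succ_iff {a : A} {k : ℕ} :
    deg a < (k + 1 : ℕ) ↔ deg a < k ∨ deg a = k := by
  by_cases h0 : a = 0
  · simp [h0, deg_zero]
  · obtain ⟨n, hn⟩ := exists_deg_eq h0
    rw [hn]
    norm_cast
    omega

theorem deg_add_eq_of_lt {b c : A} {k : ℕ} (hb : deg b = k) (hc : deg c < k) :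
    deg (b + c) = k := by
  rw [deg_add_eq_left (by rwa [hb]), hb]

open Classical in
theorem toFinset_deg_eq {b : A} {k : ℕ} (hb : deg b = k) :
    (finite_deg_eq k).toFinset = (degLT k).image (b + ·) := by
  ext a
  simp only [Set.Finite.mem_toFinset, Set.mem_ofPred_eq, Finset.mem_image, mem_degLT]
  constructor
  · intro ha
    exact ⟨b + a, deg_add_lt hb ha, by rw [← add_assoc, CharTwo.add_self_eq_zero, zero_add]⟩
  · rintro ⟨c, hc, rfl⟩
    exact deg_add_eq_of_lt hb hc

open Classical in
theorem degLT_succ {b : A} {k : ℕ} (hb : deg b = k) :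
    degLT (k + 1) = degLT k ∪ (degLT k).image (b + ·) := by
  rw [← toFinset_deg_eq hb]
  ext a
  rw [Finset.mem_union, mem_degLT, mem_degLT, deg_lt_succ_iff]
  simp

open Classical in
theorem disjoint_degLT {b : A} {k : ℕ} (hb : deg b = k) :
    Disjoint (degLT k) ((degLT k).image (b + ·)) := by
  rw [← toFinset_deg_eq hb, Finset.disjoint_left]
  intro a ha ha'
  rw [mem_degLT] at ha
  simp only [Set.Finite.mem_toFinset, Set.mem_ofPred_eq] at ha'
  exact (ha'.symm ▸ ha).false

open Classical in
theorem degLT_two : degLT 2 = {0, 1} := by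
  ext a
  rw [mem_degLT, Finset.mem_insert, Finset.mem_singleton]
  constructor
  · intro h
    by_cases h0 : a = 0
    · exact Or.inl h0
    · obtain ⟨n, hn⟩ := exists_deg_eq h0
      rw [hn] at h
      have hn2 : n < 2 := by exact_mod_cast h
      have hn1 : n ≠ 1 := by
        rintro rfl
        exact deg_ne_one a hn
      obtain rfl : n = 0 := by omega
      right
      have hlt := deg_add_lt hn (b := 1) (by simpa using deg_one)
      have hbot : deg (a + 1) = ⊥ := by
        by_contra hne
        obtain ⟨m, hm⟩ := exists_deg_eq (fun h => hne (deg_eq_bot_iff.mpr h))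
        rw [hm] at hlt
        have : m < 0 := by exact_mod_cast hlt
        omega
      exact CharTwo.add_eq_zero.mp (deg_eq_bot_iff.mp hbot)
  · rintro (rfl | rfl)
    · rw [deg_zero]
      exact WithBot.bot_lt_coe _
    · rw [deg_one]
      norm_num

/-- Each further degree adds a coset `b + degLT k` and doubles the count, starting from `{0, 1}`. -/
theorem card_degLT (n : ℕ) : (degLT (n + 2)).card = 2 ^ (n + 1) := by
  classical
  induction n with
  | zero => simp [degLT_two]
  | succ n ih =>
    obtain ⟨b, hb⟩ := exists_of_deg (n := n + 2) (by omega)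
    rw [show n + 1 + 2 = n + 2 + 1 by omega, degLT_succ hb,
      Finset.card_union_of_disjoint (disjoint_degLT hb),
      Finset.card_image_of_injective _ (add_right_injective b), ih]
    ring

/-- The coefficients of the additive polynomial `∏ (z + c)`, over the `c ∈ A` of degree less
than `n + 2`. -/
def vanishCoeff : ℕ → ℕ → A
  | 0, j => if j ≤ 1 then 1 else 0
  | n + 1, 0 => D (n + 2) * vanishCoeff n 0
  | n + 1, j + 1 => vanishCoeff n j ^ 2 + D (n + 2) * vanishCoeff n (j + 1)

theorem vanishCoeff_eq_zero {n j : ℕ} (h : n + 1 < j) : vanishCoeff n j = 0 := by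
  induction n generalizing j with
  | zero => simp only [vanishCoeff]; rw [if_neg (by omega)]
  | succ n ih =>
    obtain ⟨j, rfl⟩ : ∃ i, j = i + 1 := ⟨j - 1, by omega⟩
    simp [vanishCoeff, ih (show n + 1 < j by omega), ih (show n + 1 < j + 1 by omega)]

theorem vanishCoeff_succ_self (n : ℕ) : vanishCoeff n (n + 1) = 1 := by
  induction n with
  | zero => simp [vanishCoeff]
  | succ n ih => simp [vanishCoeff, ih, vanishCoeff_eq_zero]

/-- The leading coefficient is `1`, so the next one obeys `v ↦ v² + D (n + 2)`; squaring is
additive, which yields the iterated powers in the formula for `d_k`. -/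
theorem vanishCoeff_self (n : ℕ) :
    vanishCoeff n n = 1 + ∑ i ∈ Finset.Icc 2 (n + 1), D i ^ 2 ^ (n + 1 - i) := by
  induction n with
  | zero => simp [vanishCoeff]
  | succ n ih =>
    rw [vanishCoeff, ih, vanishCoeff_succ_self, mul_one,
      Finset.sum_Icc_succ_top (by omega : 2 ≤ n + 1 + 1), add_pow_char, sum_pow_char, one_pow,
      Nat.sub_self, pow_zero, pow_one, add_assoc]
    congr 2
    refine Finset.sum_congr rfl fun i hi => ?_
    rw [Finset.mem_Icc] at hi
    rw [← pow_mul, ← pow_succ, show n + 1 - i + 1 = n + 1 + 1 - i by omega]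

theorem vanishCoeff_zero (n : ℕ) : vanishCoeff n 0 = ∏ i ∈ Finset.Ico 2 (n + 2), D i := by
  induction n with
  | zero => simp [vanishCoeff]
  | succ n ih =>
    rw [vanishCoeff, ih, show n + 1 + 2 = n + 2 + 1 by omega,
      Finset.prod_Ico_succ_top (by omega : 2 ≤ n + 2), mul_comm]

/-- The value at `z` of the additive polynomial with coefficients `vanishCoeff n`. -/
def vanishEval (n : ℕ) (z : A) : A := ∑ j ∈ Finset.range (n + 2), vanishCoeff n j * z ^ 2 ^ j

theorem vanishEval_add (n : ℕ) (z w : A) :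
    vanishEval n (z + w) = vanishEval n z + vanishEval n w := by
  simp only [vanishEval, add_pow_char_pow, mul_add, Finset.sum_add_distrib]

theorem vanishEval_succ (n : ℕ) (z : A) :
    vanishEval (n + 1) z = vanishEval n z ^ 2 + D (n + 2) * vanishEval n z := by
  have h : vanishEval n z = ∑ j ∈ Finset.range (n + 3), vanishCoeff n j * z ^ 2 ^ j := by
    rw [Finset.sum_range_succ, vanishCoeff_eq_zero (by omega), zero_mul, add_zero, vanishEval]
  have hsq : vanishEval n z ^ 2 =
      ∑ j ∈ Finset.range (n + 2), vanishCoeff n j ^ 2 * z ^ 2 ^ (j + 1) := by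
    rw [vanishEval, sum_pow_char]
    exact Finset.sum_congr rfl fun j _ => by rw [mul_pow, ← pow_mul, ← pow_succ]
  rw [hsq, h, Finset.sum_range_succ' _ (n + 2), mul_add, Finset.mul_sum, ← add_assoc,
    ← Finset.sum_add_distrib, vanishEval, Finset.sum_range_succ']
  congr 1
  · refine Finset.sum_congr rfl fun j _ => ?_
    rw [vanishCoeff]
    ring
  · rw [vanishCoeff]
    ring

theorem D_eq_prod {b : A} {k : ℕ} (hb : deg b = k) : D k = ∏ c ∈ degLT k, (b + c) := by
  classical
  rw [D, toFinset_deg_eq hb, Finset.prod_image fun c _ d _ h => add_right_injective b h]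

/-- For `b` of degree `n + 2`, the product over the enlarged set is `V(z) V(z + b) = V(z) (V(z) +
V(b))` by additivity, and `V(b) = D (n + 2)`. This explains the recursion defining `vanishCoeff`. -/
theorem vanishEval_eq_prod (n : ℕ) (z : A) :
    vanishEval n z = ∏ c ∈ degLT (n + 2), (z + c) := by
  classical
  induction n generalizing z with
  | zero =>
    rw [degLT_two, Finset.prod_pair zero_ne_one]
    simp [vanishEval, Finset.sum_range_succ, vanishCoeff]
    ring
  | succ n ih =>
    obtain ⟨b, hb⟩ := exists_of_deg (n := n + 2) (by omega)
    rw [show n + 1 + 2 = n + 2 + 1 by omega, degLT_succ hb,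
      Finset.prod_union (disjoint_degLT hb),
      Finset.prod_image fun c _ d _ h => add_right_injective b h]
    simp only [← add_assoc]
    rw [← ih, ← ih, vanishEval_add, vanishEval_succ, D_eq_prod hb, ← ih]
    ring

theorem vanishEval_eq_zero {n : ℕ} {z : A} (hz : deg z < (n + 2 : ℕ)) : vanishEval n z = 0 := by
  rw [vanishEval_eq_prod]
  exact Finset.prod_eq_zero (mem_degLT.mpr hz) (CharTwo.add_self_eq_zero z)

theorem vanishEval_eq_D {n : ℕ} {z : A} (hz : deg z = (n + 2 : ℕ)) :
    vanishEval n z = D (n + 2) := by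
  rw [vanishEval_eq_prod, D_eq_prod hz]

/-! ### The coefficients of `ρ_a` as additive polynomials in `a` -/

section Comparison

variable {L : Type*} [Field L]

/-- An additive polynomial of degree at most `2 ^ n` with more than `2 ^ n` zeros vanishes. -/
theorem eq_zero_of_additive_eval_eq_zero {n : ℕ} (t : ℕ → L) (s : Finset L)
    (hs : 2 ^ n < s.card)
    (h : ∀ z ∈ s, ∑ j ∈ Finset.range (n + 1), t j * z ^ 2 ^ j = 0) {j : ℕ} (hj : j ≤ n) :
    t j = 0 := by
  let p : Polynomial L :=
    ∑ j ∈ Finset.range (n + 1), Polynomial.C (t j) * Polynomial.X ^ 2 ^ j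
  have hp : p = 0 := by
    refine Polynomial.eq_zero_of_natDegree_lt_card_of_eval_eq_zero' p s (fun z hz => ?_) ?_
    · simpa [p, Polynomial.eval_finsetSum] using h z hz
    · refine lt_of_le_of_lt (Polynomial.natDegree_sum_le_of_forall_le _ _ fun i hi => ?_) hs
      refine (Polynomial.natDegree_C_mul_X_pow_le _ _).trans ?_
      exact Nat.pow_le_pow_right two_pos (by simpa [Nat.lt_succ_iff] using hi)
  have hc : p.coeff (2 ^ j) = t j := by
    simp only [p, Polynomial.finsetSum_coeff, Polynomial.coeff_C_mul_X_pow]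
    rw [Finset.sum_eq_single j]
    · simp
    · intro i _ hij
      rw [if_neg fun h => hij (Nat.pow_right_injective le_rfl h).symm]
    · intro h
      exact absurd (Finset.mem_range.mpr (by omega)) h
  rw [← hc, hp, Polynomial.coeff_zero]

variable [Algebra A L]

theorem algebraMap_vanishEval (n : ℕ) (z : A) : algebraMap A L (vanishEval n z) =
    ∑ j ∈ Finset.range (n + 2), algebraMap A L (vanishCoeff n j) * algebraMap A L z ^ 2 ^ j := by
  simp [vanishEval]

variable [CharP L 2]

theorem toSeries_rho_coeff_eq_sum (hL : Function.Injective (algebraMap A L))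
    {g : TwistedSeries L} (hg : expSeries L * g = 1) (a : A) (k : ℕ) :
    (toSeries (rho a) : TwistedSeries L).coeff k = ∑ i ∈ Finset.range (k + 1),
      expCoeff L i * g.coeff (k - i) ^ 2 ^ i * algebraMap A L a ^ 2 ^ i := by
  have h : (toSeries (rho a) : TwistedSeries L)
      = expSeries L * TwistedSeries.monomial 0 (algebraMap A L a) * g := by
    rw [← toSeries_rho_mul_expSeries hL, mul_assoc, hg, mul_one]
  rw [h, TwistedSeries.mul_coeff, Finset.Nat.sum_antidiagonal_eq_sum_range_succ_mk]
  refine Finset.sum_congr rfl fun i _ => ?_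
  rw [TwistedSeries.mul_monomial_zero_coeff]
  change expCoeff L i * _ * _ = _
  ring

/-- The coefficient of `τ ^ (n + 2)` in `ρ_a`, an additive polynomial in `a` of degree
`2 ^ (n + 2)`, is a left multiple of `vanishEval n` by a twisted polynomial of degree `1`. -/
theorem exists_comparison (hL : Function.Injective (algebraMap A L)) {g : TwistedSeries L}
    (hg0 : g.coeff 0 = 1) (hg1 : g.coeff 1 = 1) (hg : expSeries L * g = 1) (n : ℕ) :
    ∃ μ : L,
      expCoeff L (n + 1) = expCoeff L (n + 2) * algebraMap A L (vanishCoeff n n) ^ 2 + μ ∧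
      g.coeff (n + 2) = μ * algebraMap A L (vanishCoeff n 0) ∧
      1 = expCoeff L (n + 2) * algebraMap A L (D (n + 2)) ^ 2 + μ * algebraMap A L (D (n + 2)) := by
  classical
  -- This `μ` matches the coefficients of `z^(2^(n+1))`, where `g.coeff 1 = 1` enters.
  obtain ⟨μ, hμ⟩ : ∃ μ, μ =
    expCoeff L (n + 1) - expCoeff L (n + 2) * algebraMap A L (vanishCoeff n n) ^ 2 := ⟨_, rfl⟩
  let v : ℕ → L := fun j => algebraMap A L (vanishCoeff n j)
  -- Coefficients of `P - a_(n+2) V² - μ V`; squaring `V` shifts its coefficients by one index. The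
  -- two top ones vanish by `g.coeff 0 = 1` and the choice of `μ`.
  let t : ℕ → L := fun i => expCoeff L i * g.coeff (n + 2 - i) ^ 2 ^ i -
    expCoeff L (n + 2) * (if i = 0 then 0 else v (i - 1) ^ 2) - μ * v i
  have hv : v (n + 1) = 1 := by simp [v, vanishCoeff_succ_self]
  have hv' : v (n + 2) = 0 := by simp [v, vanishCoeff_eq_zero]
  have key : ∀ z : A, (toSeries (rho z) : TwistedSeries L).coeff (n + 2) =
      expCoeff L (n + 2) * algebraMap A L (vanishEval n z) ^ 2 +
      μ * algebraMap A L (vanishEval n z) +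
      ∑ i ∈ Finset.range (n + 1), t i * algebraMap A L z ^ 2 ^ i := by
    intro z
    have h₁ : ∑ i ∈ Finset.range (n + 1), t i * algebraMap A L z ^ 2 ^ i =
        ∑ i ∈ Finset.range (n + 3), t i * algebraMap A L z ^ 2 ^ i := by
      rw [Finset.sum_range_succ _ (n + 2), Finset.sum_range_succ _ (n + 1)]
      have ht₂ : t (n + 2) = 0 := by simp [t, hv, hv', hg0]
      have ht₁ : t (n + 1) = 0 := by simp [t, hv, hg1, hμ, v]
      rw [ht₂, ht₁]
      ring
    have h₂ : algebraMap A L (vanishEval n z) =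
        ∑ i ∈ Finset.range (n + 3), v i * algebraMap A L z ^ 2 ^ i := by
      rw [Finset.sum_range_succ, hv', zero_mul, add_zero, algebraMap_vanishEval]
    have h₃ : algebraMap A L (vanishEval n z) ^ 2 = ∑ i ∈ Finset.range (n + 3),
        (if i = 0 then 0 else v (i - 1) ^ 2) * algebraMap A L z ^ 2 ^ i := by
      rw [algebraMap_vanishEval, sum_pow_char, Finset.sum_range_succ' _ (n + 2)]
      simp only [Nat.add_eq_zero_iff, one_ne_zero, and_false, if_false, if_true, zero_mul,
        add_zero, Nat.add_sub_cancel]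
      refine Finset.sum_congr rfl fun i _ => ?_
      rw [mul_pow, ← pow_mul, ← pow_succ]
    rw [toSeries_rho_coeff_eq_sum hL hg, h₁, h₃, h₂, Finset.mul_sum, Finset.mul_sum,
      ← Finset.sum_add_distrib, ← Finset.sum_add_distrib]
    refine Finset.sum_congr rfl fun i _ => ?_
    simp only [t]
    ring
  -- What is left has degree at most `2^n` but vanishes at the `2^(n+1)` elements of degree less
  -- than `n + 2`.
  have ht : ∀ j, j ≤ n → t j = 0 := by
    intro j hj
    refine eq_zero_of_additive_eval_eq_zero (n := n) t ((degLT (n + 2)).image (algebraMap A L))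
      ?_ ?_ hj
    · rw [Finset.card_image_of_injective _ hL, card_degLT]
      exact Nat.pow_lt_pow_right one_lt_two (by omega)
    · intro w hw
      obtain ⟨z, hz, rfl⟩ := Finset.mem_image.mp hw
      rw [mem_degLT] at hz
      have h := key z
      rw [toSeries_rho_coeff_eq_zero hz, vanishEval_eq_zero hz] at h
      simpa using h.symm
  refine ⟨μ, ?_, ?_, ?_⟩
  · rw [hμ]
    ring
  · have h := ht 0 (Nat.zero_le _)
    simpa [t, v, expCoeff, sub_eq_zero] using h
  · obtain ⟨z, hz⟩ := exists_of_deg (n := n + 2) (by omega)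
    have h := key z
    rw [(monicOfDegree_rho hz).1, vanishEval_eq_D hz,
      Finset.sum_eq_zero fun i hi => by
        rw [ht i (by simpa [Nat.lt_succ_iff] using hi), zero_mul], add_zero] at h
    exact h

end Comparison

/-! ### Nonvanishing -/

theorem deg_prod {ι : Type*} (s : Finset ι) (f : ι → A) :
    deg (∏ i ∈ s, f i) = ∑ i ∈ s, deg (f i) := by
  simp only [deg, map_prod, Polynomial.degree_prod]

theorem deg_D (n : ℕ) : deg (D (n + 2)) = ((n + 2) * 2 ^ (n + 1) : ℕ) := by
  obtain ⟨b, hb⟩ := exists_of_deg (n := n + 2) (by omega)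
  rw [D_eq_prod hb, deg_prod,
    Finset.sum_congr rfl fun c hc => deg_add_eq_of_lt hb (mem_degLT.mp hc), Finset.sum_const,
    card_degLT]
  push_cast
  rw [nsmul_eq_mul]
  push_cast
  ring

theorem ne_zero_of_deg_eq {a : A} {n : ℕ} (h : deg a = n) : a ≠ 0 := by
  rintro rfl
  rw [deg_zero] at h
  exact absurd h (WithBot.bot_ne_coe)

theorem deg_mul_eq {a b : A} {m n : ℕ} (ha : deg a = m) (hb : deg b = n) :
    deg (a * b) = (m + n : ℕ) := by
  rw [deg_mul, ha, hb, Nat.cast_add]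

theorem deg_add_eq_right {a b : A} {m n : ℕ} (ha : deg a ≤ m) (hb : deg b = n) (h : m < n) :
    deg (a + b) = n := by
  rw [add_comm, deg_add_eq_left, hb]
  rw [hb]
  exact ha.trans_lt (by exact_mod_cast h)

/-- The last summand `D (n + 2)` dominates. The square of the previous coefficient is only bounded
above because for `n = 0` it is `1`. -/
theorem deg_vanishCoeff_self_succ (n : ℕ) :
    deg (vanishCoeff (n + 1) (n + 1)) = ((n + 2) * 2 ^ (n + 1) : ℕ) := by
  have hpos : 0 < 2 ^ (n + 1) := by positivity
  have hle : deg (vanishCoeff n n ^ 2) ≤ ((n + 1) * 2 ^ (n + 1) : ℕ) := by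
    induction n with
    | zero => simp [vanishCoeff, deg_one]
    | succ n ih =>
      have hpos' : 0 < 2 ^ (n + 1) := by positivity
      have h : deg (vanishCoeff (n + 1) (n + 1)) = ((n + 2) * 2 ^ (n + 1) : ℕ) := by
        rw [vanishCoeff, vanishCoeff_succ_self, mul_one]
        exact deg_add_eq_right (ih hpos') (deg_D n) (by nlinarith)
      rw [pow_two, deg_mul_eq h h]
      refine le_of_eq ?_
      norm_cast
      ring
  rw [vanishCoeff, vanishCoeff_succ_self, mul_one]
  exact deg_add_eq_right hle (deg_D n) (by nlinarith)

/-- A common denominator of the coefficients of the exponential. -/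
def expDenom : ℕ → A
  | 0 => 1
  | n + 1 => expDenom n * (D (n + 2) * vanishCoeff (n + 1) (n + 1))

/-- The numerator of a coefficient of the exponential over the denominator `expDenom`. -/
def expNumer : ℕ → A
  | 0 => 1
  | n + 1 => expDenom n + expNumer n * D (n + 2)

theorem deg_expDenom (n : ℕ) : deg (expDenom n) = (n * 2 ^ (n + 2) : ℕ) := by
  induction n with
  | zero => simp [expDenom, deg_one]
  | succ n ih =>
    rw [expDenom, deg_mul_eq ih (deg_mul_eq (deg_D n) (deg_vanishCoeff_self_succ n))]
    norm_cast
    ring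

theorem deg_expNumer (n : ℕ) : deg (expNumer n) = (n * 2 ^ (n + 1) : ℕ) := by
  induction n with
  | zero => simp [expNumer, deg_one]
  | succ n ih =>
    have hpos : 0 < 2 ^ (n + 1) := by positivity
    rw [expNumer, deg_add_eq_right (deg_expDenom n).le (deg_mul_eq ih (deg_D n))]
    · norm_cast
      ring
    · rw [pow_succ 2 (n + 1)]
      nlinarith

/-- The second summand exceeds the first in degree by `2^(n+2)`. As `L` is given no valuation, the
comparison is made in `A` after clearing denominators. -/
theorem expDenom_add_ne_zero (n : ℕ) :
    expDenom (n + 1) + expNumer (n + 1) * D (n + 2) ^ 2 ≠ 0 := by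
  have hpos : 0 < 2 ^ (n + 1) := by positivity
  have h := deg_mul_eq (deg_expNumer (n + 1)) (deg_mul_eq (deg_D n) (deg_D n))
  rw [← pow_two (D (n + 2))] at h
  refine ne_zero_of_deg_eq (deg_add_eq_right (deg_expDenom (n + 1)).le h ?_)
  rw [show n + 1 + 2 = n + 1 + 1 + 1 by omega, pow_succ 2 (n + 1 + 1), pow_succ 2 (n + 1)]
  nlinarith

/-! ### Recursion and nonvanishing for the coefficients over `L` -/

section Coefficients

variable {L : Type*} [Field L] [Algebra A L] [CharP L 2]

/-- Eliminates `μ` between the first and third relations of `exists_comparison`; this is the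
recursion for `d_k` written in reciprocals. -/
theorem expCoeff_mul_eq (hL : Function.Injective (algebraMap A L)) {g : TwistedSeries L}
    (hg0 : g.coeff 0 = 1) (hg1 : g.coeff 1 = 1) (hg : expSeries L * g = 1) (n : ℕ) :
    expCoeff L (n + 2) * algebraMap A L (D (n + 2)) *
      algebraMap A L (vanishCoeff (n + 1) (n + 1)) =
    1 + expCoeff L (n + 1) * algebraMap A L (D (n + 2)) := by
  obtain ⟨μ, h₁, -, h₃⟩ := exists_comparison hL hg0 hg1 hg n
  rw [vanishCoeff, vanishCoeff_succ_self, mul_one, map_add, map_pow, h₁]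
  have h2 : (2 : L) = 0 := CharTwo.two_eq_zero
  linear_combination -h₃ - μ * algebraMap A L (D (n + 2)) * h2

theorem expCoeff_mul_expDenom (hL : Function.Injective (algebraMap A L)) {g : TwistedSeries L}
    (hg0 : g.coeff 0 = 1) (hg1 : g.coeff 1 = 1) (hg : expSeries L * g = 1) (n : ℕ) :
    expCoeff L (n + 1) * algebraMap A L (expDenom n) = algebraMap A L (expNumer n) := by
  induction n with
  | zero => simp [expCoeff, expDenom, expNumer]
  | succ n ih =>
    have h := expCoeff_mul_eq hL hg0 hg1 hg n
    rw [expDenom, expNumer, map_mul, map_mul, map_add, map_mul, ← ih]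
    linear_combination algebraMap A L (expDenom n) * h

theorem expCoeff_ne_zero (hL : Function.Injective (algebraMap A L)) {g : TwistedSeries L}
    (hg0 : g.coeff 0 = 1) (hg1 : g.coeff 1 = 1) (hg : expSeries L * g = 1) (n : ℕ) :
    expCoeff L n ≠ 0 := by
  rcases n with _ | n
  · simp [expCoeff]
  · intro h
    have h' := expCoeff_mul_expDenom hL hg0 hg1 hg n
    rw [h, zero_mul, eq_comm, map_eq_zero_iff _ hL] at h'
    exact ne_zero_of_deg_eq (deg_expNumer n) h'

theorem one_add_expCoeff_mul_ne_zero (hL : Function.Injective (algebraMap A L))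
    {g : TwistedSeries L} (hg0 : g.coeff 0 = 1) (hg1 : g.coeff 1 = 1)
    (hg : expSeries L * g = 1) (n : ℕ) :
    1 + expCoeff L (n + 2) * algebraMap A L (D (n + 2)) ^ 2 ≠ 0 := by
  intro h
  have h' := expCoeff_mul_expDenom hL hg0 hg1 hg (n + 1)
  refine expDenom_add_ne_zero n (hL ?_)
  rw [map_add, map_mul, map_pow, ← h', map_zero]
  linear_combination algebraMap A L (expDenom (n + 1)) * h

end Coefficients

end DrinfeldExample

end

/-! ### The formulas for `d_k` and `ℓ_k` -/

open DrinfeldExample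

theorem mainTheorem1 {L : Type*} [Field L] [Algebra DrinfeldExample.A L]
    (hL : Function.Injective (algebraMap DrinfeldExample.A L))
    (D : ℕ → L) (hD : ∀ k, D k = algebraMap DrinfeldExample.A L (DrinfeldExample.D k)) :
    ∃ d ℓ : ℕ → L,
      (∀ k, d k ≠ 0) ∧ (∀ k, ℓ k ≠ 0) ∧
      (∀ e : PowerSeries L,
        DrinfeldExample.IsExponential e ↔
          e = DrinfeldExample.linearSeries fun i => 1 / d i) ∧
      (∀ e l : PowerSeries L, DrinfeldExample.IsExponential e →
        (DrinfeldExample.IsLogarithm e l ↔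
          l = DrinfeldExample.linearSeries fun i => 1 / ℓ i)) ∧
      d 2 = D 2 ∧
      (∀ k, 2 ≤ k → d (k - 1) + D k ≠ 0 ∧
        d k = D k * d (k - 1) / (d (k - 1) + D k) *
          (1 + ∑ i ∈ Finset.Icc 2 k, D i ^ 2 ^ (k - i))) ∧
      (∀ k, 2 ≤ k → (d k + D k ^ 2) * ∏ i ∈ Finset.Ico 2 k, D i ≠ 0 ∧
        ℓ k = D k * d k / ((d k + D k ^ 2) * ∏ i ∈ Finset.Ico 2 k, D i)) := by
  have : CharP L 2 := charP_of_injective_algebraMap hL 2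
  have h2 : (2 : L) = 0 := CharTwo.two_eq_zero
  obtain ⟨g, hg0, hg⟩ := TwistedSeries.exists_mul_eq_one (expSeries L) rfl
  have hg1 : g.coeff 1 = 1 := by
    have h := congrArg (fun f => f.coeff 1) hg
    simp only [TwistedSeries.mul_coeff, TwistedSeries.one_coeff, expSeries,
      Finset.Nat.sum_antidiagonal_eq_sum_range_succ_mk, Finset.sum_range_succ] at h
    simp [expCoeff, hg0] at h
    linear_combination h - h2
  have hD0 : ∀ n, D (n + 2) ≠ 0 := fun n => by
    rw [hD, Ne, map_eq_zero_iff _ hL]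
    exact ne_zero_of_deg_eq (deg_D n)
  have hprod0 : ∀ n, ∏ i ∈ Finset.Ico 2 (n + 2), D i ≠ 0 := fun n =>
    Finset.prod_ne_zero_iff.mpr fun i hi => by
      obtain ⟨j, rfl⟩ := Nat.exists_eq_add_of_le' (Finset.mem_Ico.mp hi).1
      exact hD0 j
  have hprod : ∀ n, algebraMap A L (vanishCoeff n 0) = ∏ i ∈ Finset.Ico 2 (n + 2), D i := by
    intro n
    simp [vanishCoeff_zero, hD]
  have hU : ∀ n, algebraMap A L (vanishCoeff (n + 1) (n + 1)) =
      1 + ∑ i ∈ Finset.Icc 2 (n + 2), D i ^ 2 ^ (n + 2 - i) := by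
    intro n
    simp [vanishCoeff_self, hD]
  have hU0 : ∀ n, 1 + ∑ i ∈ Finset.Icc 2 (n + 2), D i ^ 2 ^ (n + 2 - i) ≠ 0 := fun n => by
    rw [← hU, Ne, map_eq_zero_iff _ hL]
    exact ne_zero_of_deg_eq (deg_vanishCoeff_self_succ n)
  have ha0 := expCoeff_ne_zero hL hg0 hg1 hg
  have hstep : ∀ n, expCoeff L (n + 2) * D (n + 2) *
      (1 + ∑ i ∈ Finset.Icc 2 (n + 2), D i ^ 2 ^ (n + 2 - i)) =
      1 + expCoeff L (n + 1) * D (n + 2) := by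
    intro n
    rw [← hU, hD]
    exact expCoeff_mul_eq hL hg0 hg1 hg n
  have hnum : ∀ n, 1 + expCoeff L (n + 2) * D (n + 2) ^ 2 ≠ 0 := by
    intro n
    rw [hD]
    exact one_add_expCoeff_mul_ne_zero hL hg0 hg1 hg n
  -- In characteristic two the third comparison relation reads `μ D = 1 + a D²`; it is substituted
  -- into `g = μ v_0`.
  have hlog : ∀ n, g.coeff (n + 2) * D (n + 2) =
      (1 + expCoeff L (n + 2) * D (n + 2) ^ 2) * ∏ i ∈ Finset.Ico 2 (n + 2), D i := by
    intro n
    obtain ⟨μ, -, h₂, h₃⟩ := exists_comparison hL hg0 hg1 hg n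
    rw [h₂, hprod]
    rw [← hD] at h₃
    linear_combination (-∏ i ∈ Finset.Ico 2 (n + 2), D i) * h₃ -
      expCoeff L (n + 2) * D (n + 2) ^ 2 * (∏ i ∈ Finset.Ico 2 (n + 2), D i) * h2
  have hb0 : ∀ k, g.coeff k ≠ 0
    | 0 => by simp [hg0]
    | 1 => by simp [hg1]
    | n + 2 => fun h => by
      have h' := hlog n
      rw [h, zero_mul] at h'
      exact mul_ne_zero (hnum n) (hprod0 n) h'.symm
  refine ⟨fun k => 1 / expCoeff L k, fun k => 1 / g.coeff k,
    fun k => one_div_ne_zero (ha0 k), fun k => one_div_ne_zero (hb0 k), fun e => ?_,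
    fun e l he => ?_, ?_, fun k hk => ?_, fun k hk => ?_⟩
  · simpa only [one_div_one_div] using isExponential_iff hL e
  · rw [(isExponential_iff hL e).mp he]
    simp only [one_div_one_div]
    exact isLogarithm_linearSeries_iff (f := expSeries L) rfl hg l
  · have h := hstep 0
    have hu := hU0 0
    have h1 : expCoeff L 1 = 1 := by simp [expCoeff]
    simp only [zero_add, Finset.Icc_self, Finset.sum_singleton, Nat.sub_self, pow_zero, pow_one,
      h1, one_mul] at h hu
    -- As `a_1 = 1`, both sides of the recursion contain the nonzero factor `1 + D 2`.
    have h' : expCoeff L 2 * D 2 = 1 := mul_right_cancel₀ hu (by rw [h, one_mul])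
    exact (eq_one_div_of_mul_eq_one_right h').symm
  · obtain ⟨n, rfl⟩ := Nat.exists_eq_add_of_le' hk
    have h := hstep n
    -- The recursion exhibits `d_(k-1) + D_k` as a quotient of nonzero factors, which also gives its
    -- nonvanishing.
    have hsum : 1 / expCoeff L (n + 1) + D (n + 2) = expCoeff L (n + 2) * D (n + 2) *
        (1 + ∑ i ∈ Finset.Icc 2 (n + 2), D i ^ 2 ^ (n + 2 - i)) / expCoeff L (n + 1) := by
      rw [h, add_div, mul_div_cancel_left₀ _ (ha0 _)]
    simp only [show n + 2 - 1 = n + 1 by omega]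
    rw [hsum]
    have h₁ := ha0 (n + 1)
    have h₂ := ha0 (n + 2)
    have h₃ := hU0 n
    have h₄ := hD0 n
    refine ⟨div_ne_zero (mul_ne_zero (mul_ne_zero h₂ h₄) h₃) h₁, ?_⟩
    generalize 1 + ∑ i ∈ Finset.Icc 2 (n + 2), D i ^ 2 ^ (n + 2 - i) = u at h₃
    field_simp
  · obtain ⟨n, rfl⟩ := Nat.exists_eq_add_of_le' hk
    have h := hlog n
    have h₂ := ha0 (n + 2)
    have h₃ := hb0 (n + 2)
    have h₄ := hD0 n
    have h₅ := hnum n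
    have h₆ := hprod0 n
    generalize ∏ i ∈ Finset.Ico 2 (n + 2), D i = u at h h₆
    have hsum : 1 / expCoeff L (n + 2) + D (n + 2) ^ 2 =
        (1 + expCoeff L (n + 2) * D (n + 2) ^ 2) / expCoeff L (n + 2) := by
      field_simp
    simp only
    rw [hsum]
    refine ⟨mul_ne_zero (div_ne_zero h₅ h₂) h₆, ?_⟩
    rw [eq_div_iff (mul_ne_zero (div_ne_zero h₅ h₂) h₆)]
    field_simp
    linear_combination -h
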